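/- **Setting.** Let $\mathbb X\subset\mathbb R^m$ and $\mathbb Y\subset\mathbb R^n$ be Borel sets and let $\mathbb U\subset\mathbb R^k$ be finite. Consider a partially observed Markov decision process with hidden state $X_t\in\mathbb X$, observation $Y_t\in\mathbb Y$, action $U_t\in\mathbb U$, transition kernel $\mathcal T(dx'|x,u)$, observation channel $O(dy|x)$ and measurable stage cost $c:\mathbb X\times\mathbb U\to\mathbb R$. An admissible policy $\gamma=(\gamma_t)_{t\ge0}\in\Gamma$ chooses $U_t=\gamma_t(I_t)$ with $\gamma_t$ a measurable function of $I_t=(Y_0,\dots,Y_t,U_0,\dots,U_{t-1})$. For an initial distribution $\mu_0$ of $X_0$ and $\beta\in(0,1)$ let $$J_\beta(\mu_0,\gamma)=\sum_{t=0}^\infty\beta^tE^\gamma_{\mu_0}[c(X_t,U_t)],\qquad J^*_\beta(\mu_0)=\inf_{\gamma\in\Gamma}J_\beta(\mu_0,\gamma).$$ **Discretized model.** Let $A_0,\dots,A_M$ be a partition of $\mathbb X$ into Borel sets, let $\psi(x)=i$ for $x\in A_i$, and put $$L_{\mathbb X}=\max_{0\le i\le M}\ \sup_{x,x'\in A_i}\|x-x'\|\in[0,\infty].$$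 Let $\pi$ be a probability measure on $\mathbb X$ with $\pi(A_i)>0$ for every $i$, and let $\pi_i=\pi(\cdot\cap A_i)/\pi(A_i)$. The discretized model has the finite hidden state space $\{0,\dots,M\}$, the same observation and action spaces, and $$\hat{\mathcal T}(j|i,u)=\int\mathcal T(A_j|z,u)\,\pi_i(dz),\quad \hat O(\cdot|i)=\int O(\cdot|z)\,\pi_i(dz),\quad \hat c(i,u)=\int c(z,u)\,\pi_i(dz),$$ with initial distribution $\mu_0\circ\psi^{-1}$. **Assumptions.** There are constants $K_c,K_T,K_O\in[0,\infty)$ such that for all $x,z\in\mathbb X$ and $u\in\mathbb U$: * (a) $|c(x,u)-c(z,u)|\le K_c\|x-z\|$; * (b) $W_1(\mathcal T(\cdot|x,u),\mathcal T(\cdot|z,u))\le K_T\|x-z\|$, where $W_1$ is the Wasserstein distance of order one; * (c) $\|O(\cdot|x)-O(\cdot|z)\|_{TV}\le K_O\|x-z\|$ for all $x,z$, where $\|\cdot\|_{TV}$ is the total mass of the variation of a signed measure; or, alternatively, $O(dy|x)=g(x,y)\,\lambda(dy)$ for a probability measure $\lambda$ on $\mathbb Y$ and a measurable $g\ge0$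 with $|g(x,y)-g(z,y)|\le K_O\|x-z\|$ for all $x,z,y$. Assume moreover that $|c(x,u)|\le1$ for all $x,u$ and that $\beta K_T<1$. **Theorem.** Let $\hat\gamma\in\Gamma$ be an optimal policy for the discretized model, i.e. $\hat\gamma$ minimizes the $\beta$-discounted cost of the discretized model, started from $\mu_0\circ\psi^{-1}$, over $\Gamma$. Then, applied to the true system, $$J_\beta(\mu_0,\hat\gamma)-J^*_\beta(\mu_0)\ \le\ \frac{2K_O}{(1-\beta)^2(1-\beta K_T)}\,L_{\mathbb X}+\frac{2K_c}{(1-\beta)(1-\beta K_T)}\,L_{\mathbb X},$$ where $0\cdot\infty=0$ if $L_{\mathbb X}=\infty$. -/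

import Mathlib

open MeasureTheory ProbabilityTheory
open scoped ENNReal NNReal

noncomputable section

/-- The order-one Wasserstein distance: the infimum of `∫ d(x, y) π(dx, dy)` over all couplings
`π` of `μ` and `ν`, with values in `[0, ∞]`. -/
def wasserstein1 {X : Type*} [MeasurableSpace X] [PseudoEMetricSpace X] (μ ν : Measure X) :
    ℝ≥0∞ :=
  ⨅ (π : Measure (X × X)) (_ : π.map Prod.fst = μ ∧ π.map Prod.snd = ν),
    ∫⁻ p, edist p.1 p.2 ∂π

/-- The total variation norm `‖μ - ν‖_TV`: the total mass of the variation of the signed measure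
`μ - ν`, i.e. the supremum of `|∫ f dμ - ∫ f dν|` over measurable `f` with `|f| ≤ 1`
(so it ranges over `[0, 2]` for probability measures). -/
def tvNorm {Y : Type*} [MeasurableSpace Y] (μ ν : Measure Y) [IsFiniteMeasure μ]
    [IsFiniteMeasure ν] : ℝ≥0∞ :=
  (μ.toSignedMeasure - ν.toSignedMeasure).totalVariation Set.univ

/-- A partially observed Markov decision process with hidden states `X`, observations `Y` and
actions `U`: a transition kernel `T(dx' | x, u)`, an observation channel `O(dy | x)` and a
measurable stage cost `c(x, u)`. -/
structure POMDP (X Y U : Type*) [MeasurableSpace X] [MeasurableSpace Y] [MeasurableSpace U] where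
  trans : Kernel (X × U) X
  chan : Kernel X Y
  cost : X → U → ℝ
  markov_trans : IsMarkovKernel trans
  markov_chan : IsMarkovKernel chan
  measurable_cost : Measurable (Function.uncurry cost)

attribute [instance] POMDP.markov_trans POMDP.markov_chan

/-- The information `I_t = (y_0, …, y_t, u_0, …, u_{t-1})` available at time `t`. -/
abbrev Info (Y U : Type*) (t : ℕ) : Type _ := (Fin (t + 1) → Y) × (Fin t → U)

/-- An admissible policy: at each time `t`, a measurable function of the information `I_t`. -/
structure Policy (Y U : Type*) [MeasurableSpace Y] [MeasurableSpace U] where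
  act : (t : ℕ) → Info Y U t → U
  measurable_act : ∀ t, Measurable (act t)

namespace POMDP

variable {X Y U : Type*} [MeasurableSpace X] [MeasurableSpace Y] [MeasurableSpace U]

/-- The conditional law of `(X_{t+1}, Y_{t+1})` given `X_t = x` and `I_t`, under the policy `γ`:
`T(dx' | x, γ_t(I_t)) O(dy' | x')`. -/
def stepKernel (P : POMDP X Y U) (γ : Policy Y U) (t : ℕ) :
    Kernel (X × Info Y U t) (X × Y) :=
  (P.trans.comap (fun s => (s.1, γ.act t s.2))
    (measurable_fst.prodMk ((γ.measurable_act t).comp measurable_snd))) ⊗ₖ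
    (Kernel.prodMkLeft (X × Info Y U t) P.chan)

/-- The joint law of `(X_t, I_t)` under the initial distribution `μ` and the policy `γ`:
`(X_0, Y_0)` has law `μ(dx) O(dy | x)`; then `U_t = γ_t(I_t)`, the pair `(X_{t+1}, Y_{t+1})` is
drawn from `stepKernel`, and `I_{t+1}` is `I_t` with `Y_{t+1}` and `U_t` appended. -/
def law (P : POMDP X Y U) (μ : Measure X) (γ : Policy Y U) :
    (t : ℕ) → Measure (X × Info Y U t)
  | 0 => (μ ⊗ₘ P.chan).map fun p => (p.1, (fun _ => p.2, Fin.elim0))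
  | t + 1 => (law P μ γ t ⊗ₘ P.stepKernel γ t).map fun p =>
      (p.2.1, (Fin.snoc p.1.2.1 p.2.2, Fin.snoc p.1.2.2 (γ.act t p.1.2)))

/-- The infinite horizon discounted cost `J_β(μ, γ) = ∑ₜ β^t E[c(X_t, U_t)]`. -/
def discountedCost (P : POMDP X Y U) (β : ℝ) (μ : Measure X) (γ : Policy Y U) : ℝ :=
  ∑' t : ℕ, β ^ t * ∫ s, P.cost s.1 (γ.act t s.2) ∂(P.law μ γ t)

/-- The optimal cost `J_β^*(μ) = inf_γ J_β(μ, γ)` over all admissible policies. -/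
def optimalCost (P : POMDP X Y U) (β : ℝ) (μ : Measure X) : ℝ :=
  ⨅ γ : Policy Y U, P.discountedCost β μ γ

/-- `γ` is an optimal policy for the initial distribution `μ`. -/
def IsOptimal (P : POMDP X Y U) (β : ℝ) (μ : Measure X) (γ : Policy Y U) : Prop :=
  ∀ γ' : Policy Y U, P.discountedCost β μ γ ≤ P.discountedCost β μ γ'

/-- The channel has a density `g(x, y)` with respect to some probability measure `lam` on `Y`,
with `|g(x, y) - g(z, y)| ≤ K d(x, z)`. -/
def HasLipschitzDensity [PseudoMetricSpace X] (P : POMDP X Y U) (K : ℝ≥0) : Prop :=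
  ∃ (lam : Measure Y) (g : X → Y → ℝ), IsProbabilityMeasure lam ∧
    Measurable (Function.uncurry g) ∧ (∀ x y, 0 ≤ g x y) ∧
    (∀ x, P.chan x = lam.withDensity fun y => ENNReal.ofReal (g x y)) ∧
    ∀ x z y, |g x y - g z y| ≤ K * dist x z

end POMDP

/-- The quantization cell `A_i = {x | ψ x = i}` of a quantization map `ψ`; the cells of measurable
maps `ψ : X → Fin (M + 1)` are exactly the partitions of `X` into `M + 1` measurable sets. -/
def cell {X : Type*} {M : ℕ} (ψ : X → Fin (M + 1)) (i : Fin (M + 1)) : Set X := ψ ⁻¹' {i}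

/-- `L_X = max_i sup_{x, x' ∈ A_i} d(x, x')`, with values in `[0, ∞]`. -/
def maxCellDiam {X : Type*} [PseudoEMetricSpace X] {M : ℕ} (ψ : X → Fin (M + 1)) : ℝ≥0∞ :=
  ⨆ i, ⨆ x ∈ cell ψ i, ⨆ x' ∈ cell ψ i, edist x x'

/-- The normalized weighting measure `π_i = π(· ∩ A_i) / π(A_i)` on the cell `A_i`. -/
def cellMeasure {X : Type*} [MeasurableSpace X] {M : ℕ} (π : Measure X) (ψ : X → Fin (M + 1))
    (i : Fin (M + 1)) : Measure X :=
  ProbabilityTheory.cond π (cell ψ i)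

namespace POMDP

variable {X Y U : Type*} [MeasurableSpace X] [MeasurableSpace Y] [MeasurableSpace U] {M : ℕ}

/-- The discretized transition kernel on the finite set of cells:
`T̂(j | i, u) = ∫ T(A_j | z, u) π_i(dz)`. -/
def discTrans (P : POMDP X Y U) (π : Measure X) [IsProbabilityMeasure π] (ψ : X → Fin (M + 1))
    (hψ : Measurable ψ) : Kernel (Fin (M + 1) × U) (Fin (M + 1)) where
  toFun p := ((cellMeasure π ψ p.1).bind fun z => P.trans (z, p.2)).map ψ
  measurable' := by
    refine measurable_from_prod_countable_right fun i => ?_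
    refine (Measure.measurable_map ψ hψ).comp ?_
    refine Measure.measurable_of_measurable_coe _ fun s hs => ?_
    have hT : ∀ u : U, Measurable fun z => P.trans (z, u) := fun u =>
      P.trans.measurable.comp measurable_prodMk_right
    have : ∀ u : U, ((cellMeasure π ψ i).bind fun z => P.trans (z, u)) s
        = ∫⁻ z, P.trans (z, u) s ∂(cellMeasure π ψ i) := fun u =>
      Measure.bind_apply hs (hT u).aemeasurable
    simp only [this]
    have : SFinite (cellMeasure π ψ i) := by unfold cellMeasure; infer_instance
    exact (P.trans.measurable_coe hs).lintegral_prod_left'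

/-- The discretized channel `Ô(dy | i) = ∫ O(dy | z) π_i(dz)`. -/
def discChan (P : POMDP X Y U) (π : Measure X) (ψ : X → Fin (M + 1)) :
    Kernel (Fin (M + 1)) Y where
  toFun i := (cellMeasure π ψ i).bind P.chan
  measurable' := measurable_of_finite _

/-- The averaged cost `ĉ(i, u) = ∫ c(z, u) π_i(dz)`. -/
def discCost (P : POMDP X Y U) (π : Measure X) (ψ : X → Fin (M + 1)) (i : Fin (M + 1)) (u : U) :
    ℝ :=
  ∫ z, P.cost z u ∂(cellMeasure π ψ i)

/-- The discretized model on the finite hidden state space, obtained from the quantization map `ψ`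
and a weighting probability measure `π` that charges every cell. -/
def discretize (P : POMDP X Y U) (π : Measure X) [IsProbabilityMeasure π] (ψ : X → Fin (M + 1))
    (hψ : Measurable ψ) (hpos : ∀ i, π (cell ψ i) ≠ 0) : POMDP (Fin (M + 1)) Y U where
  trans := P.discTrans π ψ hψ
  chan := P.discChan π ψ
  cost := P.discCost π ψ
  markov_trans := by
    refine ⟨fun p => ?_⟩
    have hT : Measurable fun z => P.trans (z, p.2) :=
      P.trans.measurable.comp measurable_prodMk_right
    have : IsProbabilityMeasure (cellMeasure π ψ p.1) := cond_isProbabilityMeasure (hpos p.1)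
    have : IsProbabilityMeasure ((cellMeasure π ψ p.1).bind fun z => P.trans (z, p.2)) := by
      refine ⟨?_⟩
      rw [Measure.bind_apply MeasurableSet.univ hT.aemeasurable]
      simp
    exact Measure.isProbabilityMeasure_map hψ.aemeasurable
  markov_chan := by
    refine ⟨fun i => ?_⟩
    have : IsProbabilityMeasure (cellMeasure π ψ i) := cond_isProbabilityMeasure (hpos i)
    refine ⟨?_⟩
    change ((cellMeasure π ψ i).bind P.chan) Set.univ = 1
    rw [Measure.bind_apply MeasurableSet.univ P.chan.measurable.aemeasurable]
    simp
  measurable_cost := by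
    refine measurable_from_prod_countable_right fun i => ?_
    have : SFinite (cellMeasure π ψ i) := by unfold cellMeasure; infer_instance
    exact (P.measurable_cost.stronglyMeasurable.integral_prod_left'
      (μ := cellMeasure π ψ i)).measurable

end POMDP

end

/-!
The policy `γ` that is optimal for the discretized model is nearly optimal for the true one because
every fixed policy has nearly the same cost in both models: if the two costs of any policy differ by
at most `D`, then `J(γ) ≤ Ĵ(γ) + D ≤ Ĵ(γ') + D ≤ J(γ') + 2 D` for every policy `γ'`.

For a fixed policy, the comparison runs through the finite-horizon cost-to-go as a function of the
hidden state `x` and the information `I` (`POMDP.costToGo`), and through its average over the next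
observation (`POMDP.preObsCost`). With costs bounded by one, all of these are bounded by
`B = 1 / (1 - β)`.

* `POMDP.abs_costToGo_sub_le`: these functions are Lipschitz in the hidden state, uniformly in the
  horizon. Changing `x` changes the stage cost by at most `K_c d`, a transition multiplies the
  Lipschitz constant by `β K_T` (Kantorovich–Rubinstein duality), and averaging over the observation
  adds `B K_O`. The constant before the observation is thus the fixed point
  `K = (K_c + B K_O) / (1 - β K_T)`.
* `POMDP.abs_costToGo_sub_discretize_le`: the kernels of the discretized model average those of the
  true model over a cell, so that each step of the recursion replaces a hidden state by others in
  its cell. In one step the costs drift apart by at most `K L`, and the differences before the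
  observation are bounded by the fixed point `D = K L / (1 - β)`, where `L` is the largest diameter
  of a cell.

Letting the horizon tend to infinity gives `POMDP.abs_discountedCost_sub_discretize_le`, and
`2 D` is the asserted bound.
-/

/-! ### Integrals of bounded functions -/

lemma Measurable.integrable_of_abs_le {α : Type*} [MeasurableSpace α] {μ : Measure α}
    [IsFiniteMeasure μ] {f : α → ℝ} (hf : Measurable f) {B : ℝ} (hB : ∀ x, |f x| ≤ B) :
    Integrable f μ :=
  .of_bound hf.aestronglyMeasurable B (ae_of_all _ hB)

lemma abs_integral_le_of_abs_le {α : Type*} [MeasurableSpace α] {μ : Measure α}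
    [IsProbabilityMeasure μ] {f : α → ℝ} {B : ℝ} (hB : ∀ x, |f x| ≤ B) :
    |∫ x, f x ∂μ| ≤ B := by
  simpa using norm_integral_le_of_norm_le_const (μ := μ) (f := f) (ae_of_all _ hB)

lemma abs_integral_sub_integral_le {α : Type*} [MeasurableSpace α] {μ : Measure α}
    [IsProbabilityMeasure μ] {f g : α → ℝ} (hf : Integrable f μ) (hg : Integrable g μ) {e : ℝ}
    (h : ∀ x, |f x - g x| ≤ e) : |∫ x, f x ∂μ - ∫ x, g x ∂μ| ≤ e := by
  rw [← integral_sub hf hg]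
  exact abs_integral_le_of_abs_le h

lemma abs_sub_integral_le_of_ae {α : Type*} [MeasurableSpace α] {μ : Measure α}
    [IsProbabilityMeasure μ] {f : α → ℝ} (hf : Integrable f μ) {a e : ℝ}
    (h : ∀ᵐ x ∂μ, |a - f x| ≤ e) : |a - ∫ x, f x ∂μ| ≤ e := by
  have : a - ∫ x, f x ∂μ = ∫ x, (a - f x) ∂μ := by
    rw [integral_sub (integrable_const a) hf]; simp
  rw [this]
  simpa using norm_integral_le_of_norm_le_const (μ := μ) (f := fun x => a - f x) h

lemma integral_measure_bind {α β : Type*} [MeasurableSpace α] [MeasurableSpace β] {μ : Measure α}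
    [IsProbabilityMeasure μ] (κ : Kernel α β) [IsMarkovKernel κ] {f : β → ℝ} (hf : Measurable f)
    {B : ℝ} (hB : ∀ x, |f x| ≤ B) :
    ∫ b, f b ∂(μ.bind κ) = ∫ a, ∫ b, f b ∂κ a ∂μ := by
  rw [← Measure.snd_compProd, Measure.snd,
    integral_map measurable_snd.aemeasurable hf.aestronglyMeasurable, Measure.integral_compProd]
  exact (hf.comp measurable_snd).integrable_of_abs_le fun p => hB p.2

/-! ### Wasserstein distance and total variation as bounds on differences of integrals -/

/-- The easy half of Kantorovich–Rubinstein duality, for bounded Lipschitz functions. -/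
lemma abs_integral_sub_le_of_wasserstein1_le {X : Type*} [MeasurableSpace X]
    [PseudoMetricSpace X] {μ ν : Measure X} [IsProbabilityMeasure μ]
    {f : X → ℝ} (hf : Measurable f) {B : ℝ} (hB : ∀ x, |f x| ≤ B) {K : ℝ} (hK : 0 ≤ K)
    (hlip : ∀ x z, |f x - f z| ≤ K * dist x z) {w : ℝ} (hw : 0 ≤ w)
    (h : wasserstein1 μ ν ≤ ENNReal.ofReal w) :
    |∫ x, f x ∂μ - ∫ x, f x ∂ν| ≤ K * w := by
  have key : ∀ w', w < w' → |∫ x, f x ∂μ - ∫ x, f x ∂ν| ≤ K * w' := by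
    intro w' hw'
    have hlt : wasserstein1 μ ν < ENNReal.ofReal w' :=
      h.trans_lt ((ENNReal.ofReal_lt_ofReal_iff (hw.trans_lt hw')).2 hw')
    simp only [wasserstein1, iInf_lt_iff] at hlt
    obtain ⟨ρ, ⟨rfl, rfl⟩, hρ⟩ := hlt
    have : IsProbabilityMeasure ρ :=
      Measure.isProbabilityMeasure_of_map Prod.fst
    rw [integral_map measurable_fst.aemeasurable hf.aestronglyMeasurable,
      integral_map measurable_snd.aemeasurable hf.aestronglyMeasurable,
      ← integral_sub (f := fun p : X × X => f p.1) (g := fun p : X × X => f p.2)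
        ((hf.comp measurable_fst).integrable_of_abs_le fun p => hB p.1)
        ((hf.comp measurable_snd).integrable_of_abs_le fun p => hB p.2),
      ← ENNReal.ofReal_le_ofReal_iff (mul_nonneg hK (hw.trans hw'.le)), ENNReal.ofReal_mul hK]
    calc ENNReal.ofReal |∫ p, (f p.1 - f p.2) ∂ρ|
        ≤ ∫⁻ p, ENNReal.ofReal |f p.1 - f p.2| ∂ρ := by
          rw [← Real.enorm_eq_ofReal_abs]
          simpa only [Real.enorm_eq_ofReal_abs] using
            enorm_integral_le_lintegral_enorm (μ := ρ) fun p => f p.1 - f p.2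
      _ ≤ ∫⁻ p, ENNReal.ofReal K * edist p.1 p.2 ∂ρ := by
          refine lintegral_mono fun p => ?_
          rw [edist_dist, ← ENNReal.ofReal_mul hK]
          exact ENNReal.ofReal_le_ofReal (hlip _ _)
      _ = ENNReal.ofReal K * ∫⁻ p, edist p.1 p.2 ∂ρ :=
          lintegral_const_mul' _ _ ENNReal.ofReal_ne_top
      _ ≤ ENNReal.ofReal K * ENNReal.ofReal w' := by gcongr
  have hlim : Filter.Tendsto (fun w' => K * w') (nhdsWithin w (Set.Ioi w)) (nhds (K * w)) :=
    ((continuous_const.mul continuous_id).tendsto w).mono_left nhdsWithin_le_nhds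
  exact ge_of_tendsto hlim (Filter.eventually_of_mem self_mem_nhdsWithin key)

lemma abs_integral_sub_le_of_tvNorm_le {Y : Type*} [MeasurableSpace Y] {μ ν : Measure Y}
    [IsFiniteMeasure μ] [IsFiniteMeasure ν] {f : Y → ℝ} (hf : Measurable f) {B : ℝ}
    (hB0 : 0 ≤ B) (hB : ∀ y, |f y| ≤ B) {e : ℝ} (he : 0 ≤ e) (h : tvNorm μ ν ≤ ENNReal.ofReal e) :
    |∫ y, f y ∂μ - ∫ y, f y ∂ν| ≤ B * e := by
  -- The two parts of the Jordan decomposition have difference `μ - ν`, and their masses add up to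
  -- `tvNorm μ ν`.
  set j := (μ.toSignedMeasure - ν.toSignedMeasure).toJordanDecomposition with hj
  have hs : j.posPart + ν = j.negPart + μ := by
    rw [← Measure.toSignedMeasure_eq_toSignedMeasure_iff,
      Measure.toSignedMeasure_add, Measure.toSignedMeasure_add]
    have : j.posPart.toSignedMeasure - j.negPart.toSignedMeasure
        = μ.toSignedMeasure - ν.toSignedMeasure :=
      SignedMeasure.toSignedMeasure_toJordanDecomposition _
    rw [sub_eq_sub_iff_add_eq_add] at this
    rw [this, add_comm]
  have hint : ∀ (ρ : Measure Y) [IsFiniteMeasure ρ], Integrable f ρ := fun ρ _ =>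
    hf.integrable_of_abs_le hB
  have hI : ∫ y, f y ∂μ - ∫ y, f y ∂ν = ∫ y, f y ∂j.posPart - ∫ y, f y ∂j.negPart := by
    have := congrArg (fun ρ => ∫ y, f y ∂ρ) hs
    simp only [integral_add_measure (hint _) (hint _)] at this
    linarith
  have hpart : ∀ (ρ : Measure Y) [IsFiniteMeasure ρ], |∫ y, f y ∂ρ| ≤ B * ρ.real Set.univ :=
    fun ρ _ => norm_integral_le_of_norm_le_const (f := f) (ae_of_all _ hB)
  have htv : j.posPart.real Set.univ + j.negPart.real Set.univ ≤ e := by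
    rw [← ENNReal.ofReal_le_ofReal_iff he, ENNReal.ofReal_add (by positivity) (by positivity),
      ofReal_measureReal, ofReal_measureReal]
    simpa only [tvNorm, SignedMeasure.totalVariation, Measure.add_apply] using h
  rw [hI]
  calc _ ≤ |∫ y, f y ∂j.posPart| + |∫ y, f y ∂j.negPart| := abs_sub _ _
    _ ≤ B * j.posPart.real Set.univ + B * j.negPart.real Set.univ :=
        add_le_add (hpart _) (hpart _)
    _ ≤ B * e := by rw [← mul_add]; gcongr

lemma abs_integral_sub_le_of_abs_density_sub_le {Y : Type*} [MeasurableSpace Y] {lam : Measure Y}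
    [IsProbabilityMeasure lam] {g₁ g₂ : Y → ℝ} (hg₁ : Measurable g₁) (hg₂ : Measurable g₂)
    (h₁ : ∀ y, 0 ≤ g₁ y) (h₂ : ∀ y, 0 ≤ g₂ y)
    [IsFiniteMeasure (lam.withDensity fun y => ENNReal.ofReal (g₁ y))]
    [IsFiniteMeasure (lam.withDensity fun y => ENNReal.ofReal (g₂ y))]
    {f : Y → ℝ} (hf : Measurable f) {B : ℝ} (hB : ∀ y, |f y| ≤ B) {e : ℝ}
    (h : ∀ y, |g₁ y - g₂ y| ≤ e) :
    |∫ y, f y ∂(lam.withDensity fun y => ENNReal.ofReal (g₁ y)) -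
      ∫ y, f y ∂(lam.withDensity fun y => ENNReal.ofReal (g₂ y))| ≤ B * e := by
  have aux : ∀ g : Y → ℝ, Measurable g → (∀ y, 0 ≤ g y) →
      IsFiniteMeasure (lam.withDensity fun y => ENNReal.ofReal (g y)) →
      Integrable (fun y => g y * f y) lam ∧
      ∫ y, f y ∂(lam.withDensity fun y => ENNReal.ofReal (g y)) = ∫ y, g y * f y ∂lam := by
    intro g hg hg0 hfin
    have hmeas : Measurable fun y => ENNReal.ofReal (g y) := hg.ennreal_ofReal
    have hlt : ∀ᵐ y ∂lam, ENNReal.ofReal (g y) < ∞ := ae_of_all _ fun y => ENNReal.ofReal_lt_top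
    have hint : Integrable f (lam.withDensity fun y => ENNReal.ofReal (g y)) :=
      hf.integrable_of_abs_le hB
    rw [integrable_withDensity_iff_integrable_smul' hmeas hlt] at hint
    rw [integral_withDensity_eq_integral_toReal_smul hmeas hlt]
    simpa only [ENNReal.toReal_ofReal (hg0 _), smul_eq_mul, and_true] using hint
  obtain ⟨i₁, e₁⟩ := aux g₁ hg₁ h₁ inferInstance
  obtain ⟨i₂, e₂⟩ := aux g₂ hg₂ h₂ inferInstance
  rw [e₁, e₂]
  refine abs_integral_sub_integral_le i₁ i₂ fun y => ?_
  rw [← sub_mul, abs_mul, mul_comm]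
  exact mul_le_mul (hB y) (h y) (abs_nonneg _) ((abs_nonneg _).trans (hB y))

noncomputable section

/-! ### The finite-horizon cost-to-go of a fixed policy -/

/-- The information `I_{t+1}`, obtained from `I_t` by appending the observation `y` and the action
`γ_t(I_t)`. -/
def Policy.append {Y U : Type*} [MeasurableSpace Y] [MeasurableSpace U] (γ : Policy Y U) {t : ℕ}
    (I : Info Y U t) (y : Y) : Info Y U (t + 1) :=
  (Fin.snoc I.1 y, Fin.snoc I.2 (γ.act t I))

lemma measurable_fin_snoc {α β : Type*} [MeasurableSpace α] [MeasurableSpace β] {n : ℕ}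
    {f : α → Fin n → β} {g : α → β} (hf : Measurable f) (hg : Measurable g) :
    Measurable fun a => (Fin.snoc (f a) (g a) : Fin (n + 1) → β) := by
  refine measurable_pi_iff.2 fun i => ?_
  refine Fin.lastCases ?_ (fun i => ?_) i
  · simpa using hg
  · simpa using (measurable_pi_iff.1 hf) i

lemma Policy.measurable_append {Y U : Type*} [MeasurableSpace Y] [MeasurableSpace U]
    (γ : Policy Y U) (t : ℕ) :
    Measurable fun q : Info Y U t × Y => γ.append q.1 q.2 :=
  (measurable_fin_snoc (measurable_fst.comp measurable_fst) measurable_snd).prodMk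
    (measurable_fin_snoc (measurable_snd.comp measurable_fst)
      ((γ.measurable_act t).comp measurable_fst))

namespace POMDP

section CostToGo

variable {X Y U : Type*} [MeasurableSpace X] [MeasurableSpace Y] [MeasurableSpace U]

instance (P : POMDP X Y U) (γ : Policy Y U) (t : ℕ) : IsMarkovKernel (P.stepKernel γ t) := by
  unfold stepKernel; infer_instance

instance (P : POMDP X Y U) (μ : Measure X) [IsProbabilityMeasure μ] (γ : Policy Y U) (t : ℕ) :
    IsProbabilityMeasure (P.law μ γ t) := by
  induction t with
  | zero =>
    refine Measure.isProbabilityMeasure_map (Measurable.aemeasurable ?_)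
    exact measurable_fst.prodMk
      ((measurable_pi_iff.2 fun _ => measurable_snd).prodMk measurable_const)
  | succ t ih =>
    refine Measure.isProbabilityMeasure_map (Measurable.aemeasurable ?_)
    exact (measurable_fst.comp measurable_snd).prodMk ((γ.measurable_append t).comp
      ((measurable_snd.comp measurable_fst).prodMk (measurable_snd.comp measurable_snd)))

/-- The expected discounted cost of the stages `t, …, t + n - 1` under the policy `γ`, discounted
to time `t`, given the hidden state `x` and the information `I` at time `t`. -/
def costToGo (P : POMDP X Y U) (β : ℝ) (γ : Policy Y U) :
    (n t : ℕ) → X × Info Y U t → ℝ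
  | 0, _, _ => 0
  | n + 1, t, s => P.cost s.1 (γ.act t s.2) +
      β * ∫ p, costToGo P β γ n (t + 1) (p.1, γ.append s.2 p.2) ∂P.stepKernel γ t s

/-- The cost-to-go at time `t + 1` as a function of the new hidden state `x`, averaged over the
observation that `x` emits, given the information `I` at time `t`. -/
def preObsCost (P : POMDP X Y U) (β : ℝ) (γ : Policy Y U) (n t : ℕ) (I : Info Y U t) (x : X) : ℝ :=
  ∫ y, P.costToGo β γ n (t + 1) (x, γ.append I y) ∂P.chan x

variable (P : POMDP X Y U) {β : ℝ} (γ : Policy Y U)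

lemma measurable_append_pair (t : ℕ) :
    Measurable fun p : (X × Info Y U t) × X × Y => (p.2.1, γ.append p.1.2 p.2.2) :=
  (measurable_fst.comp measurable_snd).prodMk ((γ.measurable_append t).comp
    ((measurable_snd.comp measurable_fst).prodMk (measurable_snd.comp measurable_snd)))

lemma measurable_stageCost (t : ℕ) :
    Measurable fun s : X × Info Y U t => P.cost s.1 (γ.act t s.2) :=
  P.measurable_cost.comp (measurable_fst.prodMk ((γ.measurable_act t).comp measurable_snd))

lemma measurable_costToGo (n t : ℕ) : Measurable (P.costToGo β γ n t) := by
  induction n generalizing t with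
  | zero => exact measurable_const
  | succ n ih =>
    refine (P.measurable_stageCost γ t).add (measurable_const.mul ?_)
    exact (((ih (t + 1)).comp
      (measurable_append_pair γ t)).stronglyMeasurable.integral_kernel_prod_right'
        (κ := P.stepKernel γ t)).measurable

lemma measurable_costToGo_append (n t : ℕ) (I : Info Y U t) :
    Measurable fun p : X × Y => P.costToGo β γ n (t + 1) (p.1, γ.append I p.2) :=
  (P.measurable_costToGo γ n (t + 1)).comp (measurable_fst.prodMk
    ((γ.measurable_append t).comp (measurable_const.prodMk measurable_snd)))

lemma measurable_preObsCost (n t : ℕ) (I : Info Y U t) :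
    Measurable (P.preObsCost β γ n t I) :=
  ((P.measurable_costToGo_append γ n t I).stronglyMeasurable.integral_kernel_prod_right'
    (κ := P.chan)).measurable

/-- `B` is the fixed point of `B = 1 + β B`, i.e. `B = 1 / (1 - β)`. -/
lemma abs_costToGo_le (hcost : ∀ x u, |P.cost x u| ≤ 1) (hβ : 0 ≤ β) {B : ℝ} (hB0 : 0 ≤ B)
    (hB : 1 + β * B = B) (n t : ℕ) (s : X × Info Y U t) : |P.costToGo β γ n t s| ≤ B := by
  induction n generalizing t with
  | zero => simpa [costToGo] using hB0
  | succ n ih =>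
    rw [costToGo, ← hB]
    refine (abs_add_le _ _).trans (add_le_add (hcost _ _) ?_)
    rw [abs_mul, abs_of_nonneg hβ]
    exact mul_le_mul_of_nonneg_left (abs_integral_le_of_abs_le fun p => ih _ _) hβ

lemma abs_preObsCost_le (hcost : ∀ x u, |P.cost x u| ≤ 1) (hβ : 0 ≤ β) {B : ℝ} (hB0 : 0 ≤ B)
    (hB : 1 + β * B = B) (n t : ℕ) (I : Info Y U t) (x : X) :
    |P.preObsCost β γ n t I x| ≤ B :=
  abs_integral_le_of_abs_le fun _ => P.abs_costToGo_le γ hcost hβ hB0 hB _ _ _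

lemma costToGo_succ (hcost : ∀ x u, |P.cost x u| ≤ 1) (hβ : 0 ≤ β) {B : ℝ} (hB0 : 0 ≤ B)
    (hB : 1 + β * B = B) (n t : ℕ) (s : X × Info Y U t) :
    P.costToGo β γ (n + 1) t s = P.cost s.1 (γ.act t s.2) +
      β * ∫ x, P.preObsCost β γ n t s.2 x ∂P.trans (s.1, γ.act t s.2) := by
  rw [costToGo, stepKernel, integral_compProd]
  · rfl
  · exact (P.measurable_costToGo_append γ n t s.2).integrable_of_abs_le
      fun p => P.abs_costToGo_le γ hcost hβ hB0 hB _ _ _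

lemma law_succ (μ : Measure X) (t : ℕ) :
    P.law μ γ (t + 1) = (P.law μ γ t ⊗ₘ P.stepKernel γ t).map
      fun p => (p.2.1, γ.append p.1.2 p.2.2) := rfl

lemma integral_costToGo_succ (hcost : ∀ x u, |P.cost x u| ≤ 1) (hβ : 0 ≤ β) {B : ℝ}
    (hB0 : 0 ≤ B) (hB : 1 + β * B = B) (μ : Measure X) [IsProbabilityMeasure μ] (n t : ℕ) :
    ∫ s, P.costToGo β γ (n + 1) t s ∂P.law μ γ t =
      ∫ s, P.cost s.1 (γ.act t s.2) ∂P.law μ γ t +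
        β * ∫ s, P.costToGo β γ n (t + 1) s ∂P.law μ γ (t + 1) := by
  have hmeas := (P.measurable_costToGo (β := β) γ n (t + 1)).comp (measurable_append_pair γ t)
  have hstep : ∫ s, P.costToGo β γ n (t + 1) s ∂P.law μ γ (t + 1) =
      ∫ s, ∫ p, P.costToGo β γ n (t + 1) (p.1, γ.append s.2 p.2) ∂P.stepKernel γ t s
        ∂P.law μ γ t := by
    rw [law_succ, integral_map (measurable_append_pair γ t).aemeasurable
      (P.measurable_costToGo γ n (t + 1)).aestronglyMeasurable]
    exact Measure.integral_compProd (hmeas.integrable_of_abs_le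
      fun p => P.abs_costToGo_le γ hcost hβ hB0 hB _ _ _)
  rw [hstep, ← integral_const_mul, ← integral_add]
  · rfl
  · exact (P.measurable_stageCost γ t).integrable_of_abs_le fun s => hcost _ _
  · refine Integrable.const_mul ?_ β
    exact (hmeas.stronglyMeasurable.integral_kernel_prod_right'
      (κ := P.stepKernel γ t)).measurable.integrable_of_abs_le
      fun s => abs_integral_le_of_abs_le fun p => P.abs_costToGo_le γ hcost hβ hB0 hB _ _ _

/-- Dynamic programming for a fixed policy: the mean cost-to-go is the sum of the expected
discounted stage costs. -/
lemma integral_costToGo (hcost : ∀ x u, |P.cost x u| ≤ 1) (hβ : 0 ≤ β) {B : ℝ}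
    (hB0 : 0 ≤ B) (hB : 1 + β * B = B) (μ : Measure X) [IsProbabilityMeasure μ] (n t : ℕ) :
    ∫ s, P.costToGo β γ n t s ∂P.law μ γ t =
      ∑ i ∈ Finset.range n, β ^ i * ∫ s, P.cost s.1 (γ.act (t + i) s.2) ∂P.law μ γ (t + i) := by
  induction n generalizing t with
  | zero => simp [costToGo]
  | succ n ih =>
    rw [P.integral_costToGo_succ γ hcost hβ hB0 hB, ih, Finset.sum_range_succ', Finset.mul_sum,
      add_comm]
    simp only [pow_zero, one_mul]
    congr 1
    refine Finset.sum_congr rfl fun i _ => ?_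
    rw [pow_succ', mul_assoc, show t + (i + 1) = t + 1 + i by omega]

lemma integral_law_zero (μ : Measure X) [IsProbabilityMeasure μ]
    {f : X × Info Y U 0 → ℝ} (hf : Measurable f) {B : ℝ} (hB : ∀ s, |f s| ≤ B) :
    ∫ s, f s ∂P.law μ γ 0 = ∫ x, ∫ y, f (x, (fun _ => y, Fin.elim0)) ∂P.chan x ∂μ := by
  have hm : Measurable fun p : X × Y => ((p.1, (fun _ => p.2, Fin.elim0)) : X × Info Y U 0) :=
    measurable_fst.prodMk ((measurable_pi_iff.2 fun _ => measurable_snd).prodMk measurable_const)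
  rw [law, integral_map hm.aemeasurable hf.aestronglyMeasurable, Measure.integral_compProd]
  exact (hf.comp hm).integrable_of_abs_le fun p => hB _

lemma tendsto_integral_costToGo (hcost : ∀ x u, |P.cost x u| ≤ 1) (hβ : 0 ≤ β) (hβ1 : β < 1)
    (μ : Measure X) [IsProbabilityMeasure μ] :
    Filter.Tendsto (fun n => ∫ s, P.costToGo β γ n 0 s ∂P.law μ γ 0) Filter.atTop
      (nhds (P.discountedCost β μ γ)) := by
  have hB0 : 0 ≤ (1 - β)⁻¹ := inv_nonneg.2 (by linarith)
  have hB : 1 + β * (1 - β)⁻¹ = (1 - β)⁻¹ := by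
    have : 1 - β ≠ 0 := by linarith
    field_simp; ring
  have hsum : Summable fun t : ℕ => β ^ t * ∫ s, P.cost s.1 (γ.act t s.2) ∂P.law μ γ t := by
    refine Summable.of_norm_bounded (summable_geometric_of_lt_one hβ hβ1) fun t => ?_
    rw [Real.norm_eq_abs, abs_mul, abs_of_nonneg (pow_nonneg hβ t)]
    exact mul_le_of_le_one_right (pow_nonneg hβ t)
      (abs_integral_le_of_abs_le fun s => hcost _ _)
  have hshift : ∀ i, ∫ s, P.cost s.1 (γ.act (0 + i) s.2) ∂P.law μ γ (0 + i) =
      ∫ s, P.cost s.1 (γ.act i s.2) ∂P.law μ γ i := fun i => by rw [zero_add]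
  simp only [P.integral_costToGo γ hcost hβ hB0 hB, hshift]
  exact hsum.hasSum.tendsto_sum_nat

end CostToGo

end POMDP

namespace POMDP

/-! ### Regularity of the cost-to-go in the hidden state -/

section Lipschitz

variable {X Y U : Type*} [MeasurableSpace X] [PseudoMetricSpace X] [MeasurableSpace Y]
  [MeasurableSpace U] (P : POMDP X Y U) {β : ℝ} (γ : Policy Y U)

/-- Both forms of the channel assumption enter the argument only through this estimate. -/
lemma abs_integral_chan_sub_le {K : ℝ≥0}
    (hchan : (∀ x z : X, tvNorm (P.chan x) (P.chan z) ≤ K * edist x z) ∨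
      P.HasLipschitzDensity K) (x z : X) {f : Y → ℝ} (hf : Measurable f) {B : ℝ} (hB0 : 0 ≤ B)
    (hB : ∀ y, |f y| ≤ B) :
    |∫ y, f y ∂P.chan x - ∫ y, f y ∂P.chan z| ≤ B * (K * dist x z) := by
  rcases hchan with h | ⟨lam, g, hlam, hg, hg0, hd, hlip⟩
  · refine abs_integral_sub_le_of_tvNorm_le hf hB0 hB (by positivity) ((h x z).trans_eq ?_)
    rw [edist_dist, ENNReal.ofReal_mul K.coe_nonneg, ENNReal.ofReal_coe_nnreal]
  · have hfin : ∀ x, IsFiniteMeasure (lam.withDensity fun y => ENNReal.ofReal (g x y)) :=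
      fun x => hd x ▸ inferInstance
    rw [hd x, hd z]
    exact abs_integral_sub_le_of_abs_density_sub_le (g₁ := g x) (g₂ := g z)
      (hg.comp measurable_prodMk_left) (hg.comp measurable_prodMk_left) (hg0 x) (hg0 z) hf hB
      fun y => hlip x z y

lemma abs_integral_trans_sub_le {K_T : ℝ≥0}
    (htrans : ∀ (x z : X) (u : U),
      wasserstein1 (P.trans (x, u)) (P.trans (z, u)) ≤ K_T * edist x z)
    (x z : X) (u : U) {f : X → ℝ} (hf : Measurable f) {B : ℝ} (hB : ∀ x, |f x| ≤ B) {K : ℝ}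
    (hK : 0 ≤ K) (hlip : ∀ x z, |f x - f z| ≤ K * dist x z) :
    |∫ x', f x' ∂P.trans (x, u) - ∫ x', f x' ∂P.trans (z, u)| ≤ K * (K_T * dist x z) := by
  refine abs_integral_sub_le_of_wasserstein1_le hf hB hK hlip (by positivity)
    ((htrans x z u).trans_eq ?_)
  rw [edist_dist, ENNReal.ofReal_mul K_T.coe_nonneg, ENNReal.ofReal_coe_nnreal]

variable {K_c K_T K_O : ℝ≥0}
  (hchan : (∀ x z : X, tvNorm (P.chan x) (P.chan z) ≤ K_O * edist x z) ∨
    P.HasLipschitzDensity K_O)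
  (hbound : ∀ x u, |P.cost x u| ≤ 1) (hβ : 0 ≤ β)
  {B : ℝ} (hB0 : 0 ≤ B) (hB : 1 + β * B = B)
include hchan hbound hβ hB0 hB

lemma abs_preObsCost_sub_le {n t : ℕ} {Λ : ℝ}
    (h : ∀ (I : Info Y U (t + 1)) (x z : X),
      |P.costToGo β γ n (t + 1) (x, I) - P.costToGo β γ n (t + 1) (z, I)| ≤ Λ * dist x z)
    (I : Info Y U t) (x z : X) :
    |P.preObsCost β γ n t I x - P.preObsCost β γ n t I z| ≤ (Λ + B * K_O) * dist x z := by
  have hm : ∀ x, Measurable fun y => P.costToGo β γ n (t + 1) (x, γ.append I y) := fun x =>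
    (P.measurable_costToGo_append γ n t I).comp measurable_prodMk_left
  have hb : ∀ x y, |P.costToGo β γ n (t + 1) (x, γ.append I y)| ≤ B := fun x y =>
    P.abs_costToGo_le γ hbound hβ hB0 hB _ _ _
  have h1 := abs_integral_sub_integral_le (μ := P.chan x) ((hm x).integrable_of_abs_le (hb x))
    ((hm z).integrable_of_abs_le (hb z)) fun y => h (γ.append I y) x z
  have h2 := P.abs_integral_chan_sub_le hchan x z (hm z) hB0 (hb z)
  calc _ ≤ _ := abs_sub_le _ _ _
    _ ≤ _ := add_le_add h1 h2
    _ = _ := by ring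

/-- The cost-to-go is Lipschitz in the hidden state uniformly in the horizon. The constant `K`, a
Lipschitz constant of the cost before the observation, is the fixed point
`K = K_c + β K_T K + B K_O` of the recursion for the Lipschitz constants. -/
lemma abs_costToGo_sub_le
    (hcost : ∀ (x z : X) (u : U), |P.cost x u - P.cost z u| ≤ K_c * dist x z)
    (htrans : ∀ (x z : X) (u : U),
      wasserstein1 (P.trans (x, u)) (P.trans (z, u)) ≤ K_T * edist x z)
    {K : ℝ} (hK0 : 0 ≤ K) (hK : K_c + β * (K_T * K) + B * K_O = K)
    (n t : ℕ) (I : Info Y U t) (x z : X) :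
    |P.costToGo β γ n t (x, I) - P.costToGo β γ n t (z, I)| ≤
      (K_c + β * (K_T * K)) * dist x z := by
  induction n generalizing t x z with
  | zero => simp only [costToGo, sub_self, abs_zero]; positivity
  | succ n ih =>
    have hG := P.abs_preObsCost_sub_le γ hchan hbound hβ hB0 hB (ih (t + 1)) I
    rw [hK] at hG
    have hT := P.abs_integral_trans_sub_le htrans x z (γ.act t I)
      (P.measurable_preObsCost (β := β) γ n t I)
      (P.abs_preObsCost_le γ hbound hβ hB0 hB n t I) hK0 hG
    rw [P.costToGo_succ γ hbound hβ hB0 hB, P.costToGo_succ γ hbound hβ hB0 hB,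
      add_sub_add_comm, ← mul_sub]
    refine (abs_add_le _ _).trans ?_
    rw [abs_mul, abs_of_nonneg hβ]
    refine (add_le_add (hcost x z _) (mul_le_mul_of_nonneg_left hT hβ)).trans_eq ?_
    ring

end Lipschitz

/-! ### Comparison with the discretized model -/

section Discretize

variable {X Y U : Type*} [MeasurableSpace X] [MeasurableSpace Y]
  [MeasurableSpace U] {M : ℕ}

lemma ae_cellMeasure {ψ : X → Fin (M + 1)} (hψ : Measurable ψ) (π : Measure X)
    (i : Fin (M + 1)) : ∀ᵐ z ∂cellMeasure π ψ i, ψ z = i :=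
  ae_cond_mem (hψ (MeasurableSet.singleton i))

lemma isProbabilityMeasure_cellMeasure {ψ : X → Fin (M + 1)} (π : Measure X)
    [IsFiniteMeasure π] (hpos : ∀ i, π (cell ψ i) ≠ 0) (i : Fin (M + 1)) :
    IsProbabilityMeasure (cellMeasure π ψ i) :=
  cond_isProbabilityMeasure (hpos i)

variable (P : POMDP X Y U) {β : ℝ} (γ : Policy Y U)
  {ψ : X → Fin (M + 1)} (hψ : Measurable ψ) (π : Measure X) [IsProbabilityMeasure π]
  (hpos : ∀ i, π (cell ψ i) ≠ 0)

lemma abs_discretize_cost_le (hbound : ∀ x u, |P.cost x u| ≤ 1) (i : Fin (M + 1)) (u : U) :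
    |(P.discretize π ψ hψ hpos).cost i u| ≤ 1 := by
  have := isProbabilityMeasure_cellMeasure π hpos i
  exact abs_integral_le_of_abs_le fun z => hbound z u

lemma integral_discretize_chan (i : Fin (M + 1)) {f : Y → ℝ} (hf : Measurable f) {B : ℝ}
    (hB : ∀ y, |f y| ≤ B) :
    ∫ y, f y ∂(P.discretize π ψ hψ hpos).chan i =
      ∫ z, ∫ y, f y ∂P.chan z ∂cellMeasure π ψ i := by
  have := isProbabilityMeasure_cellMeasure π hpos i
  exact integral_measure_bind P.chan hf hB

lemma integral_discretize_trans (i : Fin (M + 1)) (u : U) {f : Fin (M + 1) → ℝ} {B : ℝ}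
    (hB : ∀ j, |f j| ≤ B) :
    ∫ j, f j ∂(P.discretize π ψ hψ hpos).trans (i, u) =
      ∫ z, ∫ x, f (ψ x) ∂P.trans (z, u) ∂cellMeasure π ψ i := by
  have := isProbabilityMeasure_cellMeasure π hpos i
  have hf : Measurable f := measurable_of_finite f
  change ∫ j, f j ∂(((cellMeasure π ψ i).bind
    (P.trans.comap (fun z => (z, u)) measurable_prodMk_right)).map ψ) = _
  rw [integral_map hψ.aemeasurable hf.aestronglyMeasurable,
    integral_measure_bind (f := fun x => f (ψ x)) _ (hf.comp hψ) fun x => hB (ψ x)]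
  rfl

variable [PseudoMetricSpace X] {K_c K_T K_O : ℝ≥0}
  (hchan : (∀ x z : X, tvNorm (P.chan x) (P.chan z) ≤ K_O * edist x z) ∨
    P.HasLipschitzDensity K_O)
  {B : ℝ} (hB0 : 0 ≤ B) {L : ℝ} (hL_O : ∀ x z, ψ x = ψ z → K_O * dist x z ≤ K_O * L)
include hchan hB0 hL_O

lemma abs_integral_chan_sub_discretize_le (x : X) {f g : Y → ℝ} (hf : Measurable f)
    (hg : Measurable g) (hfB : ∀ y, |f y| ≤ B) (hgB : ∀ y, |g y| ≤ B) {e : ℝ}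
    (h : ∀ y, |f y - g y| ≤ e) :
    |∫ y, f y ∂P.chan x - ∫ y, g y ∂(P.discretize π ψ hψ hpos).chan (ψ x)| ≤
      e + B * (K_O * L) := by
  have := isProbabilityMeasure_cellMeasure π hpos (ψ x)
  rw [P.integral_discretize_chan hψ π hpos _ hg hgB]
  refine abs_sub_integral_le_of_ae ?_ ?_
  · exact (hg.comp measurable_snd).stronglyMeasurable.integral_kernel_prod_right'
      (κ := P.chan) |>.measurable.integrable_of_abs_le fun z => abs_integral_le_of_abs_le hgB
  · filter_upwards [ae_cellMeasure hψ π (ψ x)] with z hz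
    have h1 := abs_integral_sub_integral_le (μ := P.chan x) (hf.integrable_of_abs_le hfB)
      (hg.integrable_of_abs_le hgB) h
    have h2 := P.abs_integral_chan_sub_le hchan x z hg hB0 hgB
    calc _ ≤ _ := abs_sub_le _ _ _
      _ ≤ _ := add_le_add h1 h2
      _ ≤ _ := add_le_add_right (mul_le_mul_of_nonneg_left (hL_O x z hz.symm) hB0) _

/-- The cost-to-go of the two models under the same policy, compared along the quantization map.
The constant `D` bounds the difference of the costs before the observation; it is the fixed point
`D = K L + β D` of the recursion for these differences, where `K` is the Lipschitz constant of
`abs_costToGo_sub_le`. -/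
lemma abs_costToGo_sub_discretize_le (hbound : ∀ x u, |P.cost x u| ≤ 1) (hβ : 0 ≤ β)
    (hB : 1 + β * B = B)
    (hcost : ∀ (x z : X) (u : U), |P.cost x u - P.cost z u| ≤ K_c * dist x z)
    (htrans : ∀ (x z : X) (u : U),
      wasserstein1 (P.trans (x, u)) (P.trans (z, u)) ≤ K_T * edist x z)
    {K : ℝ} (hK0 : 0 ≤ K) (hK : K_c + β * (K_T * K) + B * K_O = K)
    (hL_c : ∀ x z, ψ x = ψ z → K_c * dist x z ≤ K_c * L)
    (hL_K : ∀ x z, ψ x = ψ z → K * dist x z ≤ K * L) (hL0 : 0 ≤ L)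
    {D : ℝ} (hD0 : 0 ≤ D) (hD : K * L + β * D = D)
    (n t : ℕ) (I : Info Y U t) (x : X) :
    |P.costToGo β γ n t (x, I) - (P.discretize π ψ hψ hpos).costToGo β γ n t (ψ x, I)| ≤
      D - B * (K_O * L) := by
  -- In this form the bound is seen to be nonnegative and to match one step of the recursion.
  have hD' : D - B * (K_O * L) = K_c * L + β * (K * (K_T * L) + D) := by
    linear_combination (-hD - L * hK)
  induction n generalizing t x with
  | zero => rw [hD']; simp only [costToGo, sub_self, abs_zero]; positivity
  | succ n ih =>
    set Q := P.discretize π ψ hψ hpos with hQ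
    have hboundQ : ∀ i u, |Q.cost i u| ≤ 1 := P.abs_discretize_cost_le hψ π hpos hbound
    have hGlip := P.abs_preObsCost_sub_le γ hchan hbound hβ hB0 hB (P.abs_costToGo_sub_le γ hchan
      hbound hβ hB0 hB hcost htrans hK0 hK n (t + 1)) I
    rw [hK] at hGlip
    have hGm := P.measurable_preObsCost (β := β) γ n t I
    have hGb := P.abs_preObsCost_le γ hbound hβ hB0 hB n t I
    have hQb := Q.abs_preObsCost_le γ hboundQ hβ hB0 hB n t I
    have hQm : Measurable fun x => Q.preObsCost β γ n t I (ψ x) :=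
      (measurable_of_finite (Q.preObsCost β γ n t I)).comp hψ
    have hG : ∀ x, |P.preObsCost β γ n t I x - Q.preObsCost β γ n t I (ψ x)| ≤ D := fun x =>
      (P.abs_integral_chan_sub_discretize_le hψ π hpos hchan hB0 hL_O x
        ((P.measurable_costToGo_append γ n t I).comp measurable_prodMk_left)
        ((Q.measurable_costToGo_append γ n t I).comp measurable_prodMk_left)
        (fun y => P.abs_costToGo_le γ hbound hβ hB0 hB _ _ _)
        (fun y => Q.abs_costToGo_le γ hboundQ hβ hB0 hB _ _ _)
        fun y => ih (t + 1) (γ.append I y) x).trans_eq (by ring)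
    have := isProbabilityMeasure_cellMeasure π hpos (ψ x)
    have hc : |P.cost x (γ.act t I) - Q.cost (ψ x) (γ.act t I)| ≤ K_c * L := by
      refine abs_sub_integral_le_of_ae ((P.measurable_cost.comp
        measurable_prodMk_right).integrable_of_abs_le fun z => hbound z _) ?_
      filter_upwards [ae_cellMeasure hψ π (ψ x)] with z hz
      exact (hcost x z _).trans (hL_c x z hz.symm)
    have hT : |∫ x', P.preObsCost β γ n t I x' ∂P.trans (x, γ.act t I) -
        ∫ j, Q.preObsCost β γ n t I j ∂Q.trans (ψ x, γ.act t I)| ≤ K * (K_T * L) + D := by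
      rw [hQ, P.integral_discretize_trans hψ π hpos _ _ hQb]
      refine abs_sub_integral_le_of_ae ?_ ?_
      · exact (((hQm.comp measurable_snd).stronglyMeasurable.integral_kernel_prod_right'
          (κ := P.trans)).measurable.comp measurable_prodMk_right).integrable_of_abs_le
            fun z => abs_integral_le_of_abs_le fun x => hQb _
      · filter_upwards [ae_cellMeasure hψ π (ψ x)] with z hz
        have h1 := P.abs_integral_trans_sub_le htrans x z (γ.act t I) hGm hGb hK0 hGlip
        have h2 := abs_integral_sub_integral_le (μ := P.trans (z, γ.act t I))
          (hGm.integrable_of_abs_le hGb) (hQm.integrable_of_abs_le fun x => hQb _) hG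
        have h3 : K * (K_T * dist x z) ≤ K * (K_T * L) := by
          rw [mul_left_comm, mul_left_comm K]
          exact mul_le_mul_of_nonneg_left (hL_K x z hz.symm) K_T.coe_nonneg
        exact (abs_sub_le _ _ _).trans (add_le_add (h1.trans h3) h2)
    rw [P.costToGo_succ γ hbound hβ hB0 hB, Q.costToGo_succ γ hboundQ hβ hB0 hB,
      add_sub_add_comm, ← mul_sub, hD']
    refine (abs_add_le _ _).trans ?_
    rw [abs_mul, abs_of_nonneg hβ]
    exact add_le_add hc (mul_le_mul_of_nonneg_left hT hβ)

omit hB0 in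
/-- Every policy has nearly the same cost in the true and in the discretized model. That the cells
have diameter at most `L` is assumed only after multiplication by `K_c` and `K_O`, so that `L = 0`
is allowed when both constants vanish, whatever the cells are. -/
lemma abs_discountedCost_sub_discretize_le (hbound : ∀ x u, |P.cost x u| ≤ 1) (hβ : 0 ≤ β)
    (hβ1 : β < 1) (hβK : β * K_T < 1)
    (hcost : ∀ (x z : X) (u : U), |P.cost x u - P.cost z u| ≤ K_c * dist x z)
    (htrans : ∀ (x z : X) (u : U),
      wasserstein1 (P.trans (x, u)) (P.trans (z, u)) ≤ K_T * edist x z)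
    (hL_c : ∀ x z, ψ x = ψ z → K_c * dist x z ≤ K_c * L) (hL0 : 0 ≤ L)
    (μ₀ : Measure X) [IsProbabilityMeasure μ₀] :
    |P.discountedCost β μ₀ γ - (P.discretize π ψ hψ hpos).discountedCost β (μ₀.map ψ) γ| ≤
      K_O / ((1 - β) ^ 2 * (1 - β * K_T)) * L + K_c / ((1 - β) * (1 - β * K_T)) * L := by
  have hb : 0 < 1 - β := by linarith
  have hk : 0 < 1 - β * K_T := by linarith
  set B : ℝ := (1 - β)⁻¹ with hBdef
  have hB0 : 0 ≤ B := by positivity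
  have hB : 1 + β * B = B := by rw [hBdef]; field_simp; ring
  set K : ℝ := (K_c + B * K_O) / (1 - β * K_T) with hKdef
  have hK0 : 0 ≤ K := by positivity
  have hK : K_c + β * (K_T * K) + B * K_O = K := by rw [hKdef]; field_simp; ring
  have hL_K : ∀ x z, ψ x = ψ z → K * dist x z ≤ K * L := fun x z h => by
    rw [hKdef, div_mul_eq_mul_div, div_mul_eq_mul_div]
    gcongr ?_ / _
    nlinarith [hL_c x z h, mul_le_mul_of_nonneg_left (hL_O x z h) hB0]
  set D : ℝ := K * L / (1 - β) with hDdef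
  have hD0 : 0 ≤ D := by positivity
  have hD : K * L + β * D = D := by rw [hDdef]; field_simp; ring
  set Q := P.discretize π ψ hψ hpos with hQ
  have hboundQ : ∀ i u, |Q.cost i u| ≤ 1 := P.abs_discretize_cost_le hψ π hpos hbound
  have : IsProbabilityMeasure (μ₀.map ψ) := Measure.isProbabilityMeasure_map hψ.aemeasurable
  have hfin : ∀ n, |∫ s, P.costToGo β γ n 0 s ∂P.law μ₀ γ 0 -
      ∫ s, Q.costToGo β γ n 0 s ∂Q.law (μ₀.map ψ) γ 0| ≤ D := by
    intro n
    have hm : Measurable fun y : Y => (((fun _ => y), Fin.elim0) : Info Y U 0) :=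
      (measurable_pi_iff.2 fun _ => measurable_id).prodMk measurable_const
    have hPb := P.abs_costToGo_le γ hbound hβ hB0 hB n 0
    have hQb := Q.abs_costToGo_le γ hboundQ hβ hB0 hB n 0
    have hPm := P.measurable_costToGo (β := β) γ n 0
    have hQm := Q.measurable_costToGo (β := β) γ n 0
    rw [P.integral_law_zero γ μ₀ hPm hPb, Q.integral_law_zero γ _ hQm hQb,
      integral_map hψ.aemeasurable (measurable_of_finite _).aestronglyMeasurable]
    refine abs_integral_sub_integral_le ?_ ?_ fun x => ?_
    · exact ((hPm.comp (measurable_fst.prodMk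
        (hm.comp measurable_snd))).stronglyMeasurable.integral_kernel_prod_right'
          (κ := P.chan)).measurable.integrable_of_abs_le
            fun x => abs_integral_le_of_abs_le fun y => hPb _
    · exact ((measurable_of_finite fun j => ∫ y, Q.costToGo β γ n 0
        (j, (fun _ => y, Fin.elim0)) ∂Q.chan j).comp hψ).integrable_of_abs_le
            fun x => abs_integral_le_of_abs_le fun y => hQb _
    · refine (P.abs_integral_chan_sub_discretize_le hψ π hpos hchan hB0 hL_O x
        (hPm.comp (measurable_const.prodMk hm)) (hQm.comp (measurable_const.prodMk hm))
        (fun y => hPb _) (fun y => hQb _) fun y =>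
          P.abs_costToGo_sub_discretize_le γ hψ π hpos hchan hB0 hL_O hbound hβ hB hcost htrans
            hK0 hK hL_c hL_K hL0 hD0 hD n 0 _ x).trans_eq (by ring)
  refine (le_of_tendsto ((P.tendsto_integral_costToGo γ hbound hβ hβ1 μ₀).sub
    (Q.tendsto_integral_costToGo γ hboundQ hβ hβ1 _)).abs (.of_forall hfin)).trans_eq ?_
  rw [hDdef, hKdef, hBdef]
  field_simp
  ring

end Discretize

end POMDP

end

/-! ### Near-optimality of the policy computed from the discretized model -/

theorem mainTheorem4 {m n k M : ℕ}
    (X : Set (EuclideanSpace ℝ (Fin m))) (hX : MeasurableSet X)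
    (Y : Set (EuclideanSpace ℝ (Fin n))) (hY : MeasurableSet Y)
    (U : Set (EuclideanSpace ℝ (Fin k))) (hU : U.Finite)
    (P : POMDP X Y U)
    (β : ℝ) (hβ0 : 0 < β) (_hβ1 : β < 1)
    (K_c K_T K_O : ℝ≥0)
    (hcost : ∀ (x z : X) (u : U), |P.cost x u - P.cost z u| ≤ K_c * dist x z)
    (htrans : ∀ (x z : X) (u : U),
      wasserstein1 (P.trans (x, u)) (P.trans (z, u)) ≤ K_T * edist x z)
    (hchan : (∀ x z : X, tvNorm (P.chan x) (P.chan z) ≤ K_O * edist x z) ∨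
      P.HasLipschitzDensity K_O)
    (hbound : ∀ (x : X) (u : U), |P.cost x u| ≤ 1)
    (hβK : β * K_T < 1)
    (ψ : X → Fin (M + 1)) (hψ : Measurable ψ)
    (π : Measure X) [IsProbabilityMeasure π] (hpos : ∀ i, π (cell ψ i) ≠ 0)
    (μ₀ : Measure X) [IsProbabilityMeasure μ₀]
    (γ : Policy Y U) (hγ : (P.discretize π ψ hψ hpos).IsOptimal β (μ₀.map ψ) γ) :
    ENNReal.ofReal (P.discountedCost β μ₀ γ - P.optimalCost β μ₀) ≤
      ENNReal.ofReal (2 * K_O / ((1 - β) ^ 2 * (1 - β * K_T))) * maxCellDiam ψ +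
      ENNReal.ofReal (2 * K_c / ((1 - β) * (1 - β * K_T))) * maxCellDiam ψ := by
  set a : ℝ := K_O / ((1 - β) ^ 2 * (1 - β * K_T)) with ha
  set b : ℝ := K_c / ((1 - β) * (1 - β * K_T)) with hb
  have hβ' : 0 < 1 - β := by linarith
  have hK' : 0 < 1 - β * K_T := by linarith
  have ha0 : 0 ≤ a := by positivity
  have hb0 : 0 ≤ b := by positivity
  have ha2 : 2 * (K_O : ℝ) / ((1 - β) ^ 2 * (1 - β * K_T)) = 2 * a := by rw [ha, mul_div_assoc]
  have hb2 : 2 * (K_c : ℝ) / ((1 - β) * (1 - β * K_T)) = 2 * b := by rw [hb, mul_div_assoc]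
  rw [ha2, hb2]
  have main : ∀ L : ℝ, 0 ≤ L → (∀ x z, ψ x = ψ z → K_c * dist x z ≤ K_c * L) →
      (∀ x z, ψ x = ψ z → K_O * dist x z ≤ K_O * L) →
      P.discountedCost β μ₀ γ - P.optimalCost β μ₀ ≤ 2 * a * L + 2 * b * L := by
    intro L hL0 hLc hLO
    have hD := fun γ' => abs_sub_le_iff.1 (P.abs_discountedCost_sub_discretize_le γ' hψ π hpos
      hchan hLO hbound hβ0.le _hβ1 hβK hcost htrans hLc hL0 μ₀)
    have : Nonempty (Policy Y U) := ⟨γ⟩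
    have : P.discountedCost β μ₀ γ - (2 * a * L + 2 * b * L) ≤ P.optimalCost β μ₀ :=
      le_ciInf fun γ' => by linarith [(hD γ).1, (hD γ').2, hγ γ']
    linarith
  by_cases h0 : K_c = 0 ∧ K_O = 0
  · -- Neither the cost nor the channel depends on the hidden state, so `main` applies with `L = 0`,
    -- even if the cells are unbounded.
    have := main 0 le_rfl (by simp [h0.1]) (by simp [h0.2])
    simp only [mul_zero, add_zero] at this
    rw [ENNReal.ofReal_of_nonpos this]
    exact zero_le
  by_cases hL : maxCellDiam ψ = ∞
  · -- One of the two coefficients is positive, so that the right-hand side is infinite.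
    have hab : 0 < a ∨ 0 < b := by
      rcases not_and_or.1 h0 with h | h
      · exact .inr (div_pos (by exact_mod_cast pos_iff_ne_zero.2 h) (by positivity))
      · exact .inl (div_pos (by exact_mod_cast pos_iff_ne_zero.2 h) (by positivity))
    rcases hab with h | h
    · rw [hL, ENNReal.mul_top (by simpa using h), top_add]
      exact le_top
    · rw [hL, ENNReal.mul_top (a := ENNReal.ofReal (2 * b)) (by simpa using h), add_top]
      exact le_top
  · have hdist : ∀ x z, ψ x = ψ z → dist x z ≤ (maxCellDiam ψ).toReal := fun x z h => by
      rw [dist_edist]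
      refine ENNReal.toReal_mono hL ?_
      exact le_iSup_of_le (ψ z) (le_iSup₂_of_le x h (le_iSup₂_of_le z rfl le_rfl))
    have := main _ ENNReal.toReal_nonneg
      (fun x z h => mul_le_mul_of_nonneg_left (hdist x z h) K_c.coe_nonneg)
      (fun x z h => mul_le_mul_of_nonneg_left (hdist x z h) K_O.coe_nonneg)
    refine (ENNReal.ofReal_le_ofReal this).trans_eq ?_
    rw [ENNReal.ofReal_add (by positivity) (by positivity), ENNReal.ofReal_mul (by positivity),
      ENNReal.ofReal_mul (p := 2 * b) (by positivity), ENNReal.ofReal_toReal hL]
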